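/- For a subgroup $H$ of a group $G$, a $\vee$-complement of $H$ is a subgroup $K\leqslant G$ with $H\vee K=\langle H\cup K\rangle=G$, and the $\vee$-corank of $H$ in $G$ is the minimum rank of a $\vee$-complement of $H$, where the rank of a group is the smallest cardinality of a generating set. For $n\geq 0$ let $F_n$ be the free group with basis $a_1,\dots,a_n$. There is an algorithm that, given $n$ and a finite subset $S$ of $F_n$ (as a finite list of words in the letters $a_1^{\pm1},\dots,a_n^{\pm1}$), outputs the $\vee$-corank of $\langle S\rangle$ in $F_n$. -/

import Mathlib

/-- The rank of a group: the smallest cardinality of a generating set. -/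
noncomputable def groupRank (G : Type*) [Group G] : Cardinal :=
  sInf {κ | ∃ T : Set G, Subgroup.closure T = ⊤ ∧ Cardinal.mk T = κ}

/-- `K` is a `∨`-complement of `H` if `H ∨ K = G`. -/
def IsJoinComplement {G : Type*} [Group G] (H K : Subgroup G) : Prop :=
  H ⊔ K = ⊤

/-- The `∨`-corank of `H`: the minimum rank of a `∨`-complement of `H`. -/
noncomputable def joinCorank {G : Type*} [Group G] (H : Subgroup G) : Cardinal :=
  sInf {κ | ∃ K : Subgroup G, IsJoinComplement H K ∧ groupRank K = κ}

/-- The infimum in `groupRank` is a minimum. -/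
theorem groupRank_isLeast (G : Type*) [Group G] :
    IsLeast {κ | ∃ T : Set G, Subgroup.closure T = ⊤ ∧ Cardinal.mk T = κ} (groupRank G) :=
  ⟨csInf_mem ⟨_, Set.univ, Subgroup.closure_univ, rfl⟩, fun _ h => csInf_le' h⟩

/-- The infimum in `joinCorank` is a minimum. -/
theorem joinCorank_isLeast {G : Type*} [Group G] (H : Subgroup G) :
    IsLeast {κ | ∃ K : Subgroup G, IsJoinComplement H K ∧ groupRank K = κ} (joinCorank H) :=
  ⟨csInf_mem ⟨_, ⊤, sup_top_eq H, rfl⟩, fun _ h => csInf_le' h⟩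

/-- The list `W` of (not necessarily reduced) words represents the finite subset `S` of the free
group on `n` letters. The letter `(i, true)` stands for the basis element `a_i` and `(i, false)`
for its inverse. -/
def RepresentsSubset {n : ℕ} (W : List (List (Fin n × Bool)))
    (S : Finset (FreeGroup (Fin n))) : Prop :=
  ∀ g : FreeGroup (Fin n), g ∈ S ↔ ∃ w ∈ W, FreeGroup.mk w = g

/-- Lists of words over `n` letters as inputs of algorithms: the letters are written as natural
numbers, so that the type of inputs does not depend on `n`. -/
def inputWords {n : ℕ} (W : List (List (Fin n × Bool))) : List (List (ℕ × Bool)) :=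
  W.map fun w => w.map fun x => ((x.1 : ℕ), x.2)

/-! ### Folding labelled graphs, phrased through the actions that receive them. -/

section Folding

/-! Let `H` be generated by the words `W`. Build a finite graph whose vertices are the suffixes of
these words together with the empty word and the positive letters. Its edges are left
multiplications by letters, and each word of `W` is identified with the empty word. An action
receiving the graph sends a vertex `p` to `p • x`, where `x` is the image of the empty word.
Identifying `p` with `q` therefore amounts to adjoining `q⁻¹ * p` to `H`, and the graph forces `x`
to be fixed exactly when the enlarged subgroup is the whole free group (`forcesAll_iff`).

The heart is the converse exchange: `k` arbitrary elements generating the free group together with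
`H` can be replaced by at most `k` identifications of vertices of this graph
(`exists_identifications`). Attach petals spelling the `k` elements; the new edges outnumber the new
vertices by `k`. Fold as in Stallings' method: each new edge that folds either absorbs a new vertex
or identifies two vertices, at the cost of one recorded pair when both are old. When nothing folds
any more, every letter acts as a partial injection of a finite set, which extends to a permutation;
in the resulting action the remaining new edges cost nothing, so the old graph with the recorded
pairs already forces the base vertex to be fixed (`forcesFixed_of_no_fold`).

Hence the corank is the least number of identifications that suffice. There are finitely many pairs
to choose from, and sufficiency is tested on the finitely many equivalence relations closed under
folding, so the search is primitive recursive. -/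

/-- The permutation attached to an optional label; the label `none` acts trivially. -/
def labelPerm {ι X : Type*} (σ : ι → Equiv.Perm X) (l : Option ι) : Equiv.Perm X :=
  l.elim 1 σ

/-- The vertex map `c` sends every labelled edge of `D` to an edge of the action `σ`. -/
def RespectsEdges {ι V X : Type*} (σ : ι → Equiv.Perm X) (c : V → X)
    (D : Set (V × Option ι × V)) : Prop :=
  ∀ e ∈ D, labelPerm σ e.2.1 (c e.1) = c e.2.2

/-- In every action receiving the labelled graph `D`, the image of `o` is a fixed point. -/
def ForcesFixed {ι V : Type} (D : Set (V × Option ι × V)) (o : V) : Prop :=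
  ∀ (X : Type) (σ : ι → Equiv.Perm X) (c : V → X), RespectsEdges σ c D → ∀ i, σ i (c o) = c o

/-- In every action receiving the labelled graph on `A ⊕ B` with edges `D` inside `A` and further
edges `E`, the image of `o` is a fixed point. -/
def ForcesFixedRel {ι A B : Type} (D : Set (A × Option ι × A)) (o : A)
    (E : List ((A ⊕ B) × Option ι × (A ⊕ B))) : Prop :=
  ∀ (X : Type) (σ : ι → Equiv.Perm X) (c : A → X) (d : B → X), RespectsEdges σ c D →
    RespectsEdges σ (Sum.elim c d) {e | e ∈ E} → ∀ i, σ i (c o) = c o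

/-- Extend a predicate on `B` to `A ⊕ B` so that it holds on `A`. -/
def extendTrue {A B : Type} (f : B → Prop) : A ⊕ B → Prop :=
  Sum.elim (fun _ => True) f

/-- Every vertex of `U` is joined to `A` by edges of `E`. -/
def ConnectedTo {ι A B : Type} (E : List ((A ⊕ B) × Option ι × (A ⊕ B))) (U : Finset B) : Prop :=
  ∀ f : B → Prop, (∀ e ∈ E, (extendTrue f e.1 ↔ extendTrue f e.2.2)) → ∀ u ∈ U, f u

/-- The identifications of pairs of vertices, as edges with trivial label. -/
def identEdges {ι A : Type*} (T : List (A × A)) : Set (A × Option ι × A) :=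
  {e | ∃ t ∈ T, e = (t.1, none, t.2)}

/-- Domain and range of a partial injection of a finite set have equal size, hence so do their
complements. -/
theorem exists_perm_extending {Y : Type*} [Finite Y] (r : Y → Y → Prop)
    (hfun : ∀ x y y', r x y → r x y' → y = y') (hinj : ∀ x x' y, r x y → r x' y → x = x') :
    ∃ τ : Equiv.Perm Y, ∀ x y, r x y → τ x = y := by
  classical
  cases nonempty_fintype Y
  let g : {x // ∃ y, r x y} → {y // ∃ x, r x y} := fun x => ⟨x.2.choose, x.1, x.2.choose_spec⟩
  have hg : Function.Bijective g := by
    constructor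
    · intro x x' h
      have h1 := x.2.choose_spec
      have h2 := x'.2.choose_spec
      have h3 : x.2.choose = x'.2.choose := congrArg Subtype.val h
      rw [h3] at h1
      exact Subtype.ext (hinj _ _ _ h1 h2)
    · rintro ⟨y, x, hxy⟩
      refine ⟨⟨x, y, hxy⟩, Subtype.ext ?_⟩
      exact hfun x _ _ (Exists.choose_spec (⟨y, hxy⟩ : ∃ y, r x y)) hxy
  refine ⟨(Equiv.ofBijective g hg).extendSubtype, fun x y hxy => ?_⟩
  rw [Equiv.extendSubtype_apply_of_mem _ x ⟨y, hxy⟩]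
  exact hfun x _ _ (Exists.choose_spec (⟨y, hxy⟩ : ∃ y, r x y)) hxy

variable {ι A B : Type}

/-- Replace the vertex `j` of `B` by `y`. -/
def substVertex [DecidableEq B] (j : B) (y : A ⊕ B) : A ⊕ B → A ⊕ B :=
  Sum.elim Sum.inl (Function.update Sum.inr j y)

/-- Replace the vertex `j` of `B` by `y` in an edge. -/
def substEdge [DecidableEq B] (j : B) (y : A ⊕ B) (e : (A ⊕ B) × Option ι × (A ⊕ B)) :
    (A ⊕ B) × Option ι × (A ⊕ B) :=
  (substVertex j y e.1, e.2.1, substVertex j y e.2.2)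

theorem elim_update_eq [DecidableEq B] {X : Type*} (c : A → X) (d : B → X) (j : B) (y : A ⊕ B)
    (v : A ⊕ B) :
    Sum.elim c (Function.update d j (Sum.elim c d y)) v = Sum.elim c d (substVertex j y v) := by
  rcases v with a | b
  · rfl
  · by_cases h : b = j
    · subst h; simp [substVertex]
    · simp [substVertex, h]

theorem elim_update_self [DecidableEq B] {X : Type*} (c : A → X) (d : B → X) (j : B) (y : A ⊕ B) :
    Sum.elim c (Function.update d j (Sum.elim c d y)) y = Sum.elim c d y := by
  rcases y with a | b
  · rfl
  · by_cases h : b = j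
    · subst h; simp
    · simp [h]

/-- A truth assignment on the contracted graph pulls back by giving `j` the value of `y`. One edge
disappears, and at most one vertex of `U`. -/
theorem ConnectedTo.subst [DecidableEq B] {E : List ((A ⊕ B) × Option ι × (A ⊕ B))} {U : Finset B}
    {e : (A ⊕ B) × Option ι × (A ⊕ B)} {j : B} {y : A ⊕ B} (h : ConnectedTo (e :: E) U)
    (he : e.1 = Sum.inr j ∧ e.2.2 = y ∨ e.1 = y ∧ e.2.2 = Sum.inr j) :
    ConnectedTo (E.map (substEdge j y)) (U.erase j) := by
  intro f hf u hu
  obtain ⟨huj, hu⟩ := Finset.mem_erase.1 hu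
  have key := h (Function.update f j (extendTrue f y)) ?_ u hu
  · simpa [huj] using key
  · have h1 : extendTrue (A := A) (Function.update f j (extendTrue f y)) (Sum.inr j) =
        extendTrue f y := by simp [extendTrue]
    have h2 : extendTrue (Function.update f j (extendTrue f y)) y = extendTrue f y :=
      elim_update_self _ f j y
    intro e' he'
    rcases List.mem_cons.1 he' with rfl | he'
    · rcases he with ⟨ha, hb⟩ | ⟨ha, hb⟩ <;> rw [ha, hb, h1, h2]
    · have := hf _ (List.mem_map_of_mem he')
      have h3 := fun v => elim_update_eq (A := A) (fun _ => True) f j y v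
      simp only [extendTrue, substEdge] at this ⊢
      rw [h3, h3]; exact this

/-- Contract an edge with an end in `B`, or drop an edge inside `A`: one edge is lost and at most
one vertex of `U`. -/
theorem ConnectedTo.card_le : ∀ {E : List ((A ⊕ B) × Option ι × (A ⊕ B))} {U : Finset B},
    ConnectedTo E U → U.card ≤ E.length := by
  classical
  intro E
  induction hN : E.length generalizing E with
  | zero =>
    intro U h
    obtain rfl := List.length_eq_zero_iff.1 hN
    rw [Nat.le_zero, Finset.card_eq_zero, Finset.eq_empty_iff_forall_notMem]
    exact fun u hu => h (fun _ => False) (by simp) u hu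
  | succ N ih =>
    intro U h
    match E, hN with
    | e :: E, hN =>
      have hN' : E.length = N := by simpa using hN
      have key : ∀ j y, (e.1 = Sum.inr j ∧ e.2.2 = y ∨ e.1 = y ∧ e.2.2 = Sum.inr j) →
          U.card ≤ N + 1 := by
        intro j y he
        have := ih (by simpa using hN') (h.subst he)
        have := Finset.pred_card_le_card_erase (s := U) (a := j)
        omega
      rcases h1 : e.1 with a | j
      · rcases h2 : e.2.2 with b | j
        · refine (ih hN' (U := U) fun f hf => h f fun e' he' => ?_).trans (Nat.le_succ _)
          rcases List.mem_cons.1 he' with rfl | he'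
          · simp [h1, h2, extendTrue]
          · exact hf e' he'
        · exact key j _ (Or.inr ⟨rfl, h2⟩)
      · exact key j _ (Or.inl ⟨h1, rfl⟩)

/-- A map from the contracted graph extends by sending `j` to the image of `y`; the identification
then holds automatically. -/
theorem ForcesFixedRel.subst [DecidableEq B] {D : Set (A × Option ι × A)} {o : A}
    {E : List ((A ⊕ B) × Option ι × (A ⊕ B))} {x x' : A ⊕ B} {j : B} {y : A ⊕ B}
    (h : ForcesFixedRel D o ((x, none, x') :: E))
    (he : x = Sum.inr j ∧ x' = y ∨ x = y ∧ x' = Sum.inr j) :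
    ForcesFixedRel D o (E.map (substEdge j y)) := by
  intro X σ c d hD hE
  refine h X σ c (Function.update d j (Sum.elim c d y)) hD ?_
  have h1 : Sum.elim c (Function.update d j (Sum.elim c d y)) (Sum.inr j) =
        Sum.elim c d y := by simp
  have h2 := elim_update_self c d j y
  intro e' he'
  rcases List.mem_cons.1 he' with rfl | he'
  · rcases he with ⟨rfl, rfl⟩ | ⟨rfl, rfl⟩
    · exact h1.trans h2.symm
    · exact h2.trans h1.symm
  · have := hE _ (List.mem_map_of_mem he')
    rw [elim_update_eq, elim_update_eq]
    exact this

/-- The edge `e` can be traded for an identification of `x` and `y`. -/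
def FoldsTo (D : Set (A × Option ι × A)) (E : List ((A ⊕ B) × Option ι × (A ⊕ B)))
    (e : (A ⊕ B) × Option ι × (A ⊕ B)) (x y : A ⊕ B) : Prop :=
  (∀ (X : Type) (σ : ι → Equiv.Perm X) (c : A → X) (d : B → X), RespectsEdges σ c D →
    RespectsEdges σ (Sum.elim c d) {e | e ∈ E} → Sum.elim c d x = Sum.elim c d y →
      labelPerm σ e.2.1 (Sum.elim c d e.1) = Sum.elim c d e.2.2) ∧
  ∀ f : B → Prop, (∀ e ∈ E, (extendTrue f e.1 ↔ extendTrue f e.2.2)) →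
    (extendTrue f x ↔ extendTrue f y) → (extendTrue f e.1 ↔ extendTrue f e.2.2)

/-- Vertices of `A` with the same image in every action receiving `D`. -/
def forcedSetoid (D : Set (A × Option ι × A)) : Setoid A where
  r a b := ∀ (X : Type) (σ : ι → Equiv.Perm X) (c : A → X), RespectsEdges σ c D → c a = c b
  iseqv := ⟨fun _ _ _ _ _ => rfl, fun h X σ c hc => (h X σ c hc).symm,
    fun h h' X σ c hc => (h X σ c hc).trans (h' X σ c hc)⟩

/-- The image of a vertex after all forced identifications in `A`. -/
def forcedClass (D : Set (A × Option ι × A)) : A ⊕ B → Quotient (forcedSetoid D) ⊕ B :=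
  Sum.map (Quotient.mk _) id

theorem elim_eq_of_forcedClass_eq {D : Set (A × Option ι × A)} {u v : A ⊕ B}
    (h : forcedClass D u = forcedClass D v) {X : Type} {σ : ι → Equiv.Perm X} {c : A → X}
    {d : B → X} (hc : RespectsEdges σ c D) : Sum.elim c d u = Sum.elim c d v := by
  rcases u with a | b <;> rcases v with a' | b' <;> simp [forcedClass] at h
  · exact Quotient.exact h X σ c hc
  · rw [h]

theorem extendTrue_iff_of_forcedClass_eq {D : Set (A × Option ι × A)} {u v : A ⊕ B}
    (h : forcedClass D u = forcedClass D v) (f : B → Prop) : extendTrue f u ↔ extendTrue f v := by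
  rcases u with a | b <;> rcases v with a' | b' <;> simp [forcedClass] at h
  · exact Iff.rfl
  · rw [h]

theorem extendTrue_of_forcedClass_eq_inl {D : Set (A × Option ι × A)} {u : A ⊕ B} {a : A}
    (h : forcedClass D u = forcedClass D (Sum.inl a)) (f : B → Prop) : extendTrue f u :=
  (extendTrue_iff_of_forcedClass_eq h f).2 trivial

/-- With no fold left, `D` and `E` define partial injections on the forced classes of `A` together
with `B`. Extend them to permutations. There the class of `o` is fixed, so `o` and its `i`-neighbour
in `D` lie in one class, which means that they agree in every action receiving `D`. -/
theorem forcesFixed_of_no_fold [Finite A] [Finite B] {D : Set (A × Option ι × A)} {o : A}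
    {E : List ((A ⊕ B) × Option ι × (A ⊕ B))}
    (ho : ∀ i, ∃ a, (o, some i, a) ∈ D) (hE : ForcesFixedRel D o E)
    (hno : ∀ e E', E.Perm (e :: E') → ∀ x y, ¬ FoldsTo D E' e x y) : ForcesFixed D o := by
  have hsplit : ∀ e ∈ E, ∃ E', E.Perm (e :: E') := by
    intro e he
    obtain ⟨s, t, rfl⟩ := List.append_of_mem he
    exact ⟨s ++ t, List.perm_middle⟩
  have hfold1 : ∀ e ∈ E, e.2.1 ≠ none := by
    rintro ⟨u, l, v⟩ he rfl
    obtain ⟨E', hE'⟩ := hsplit _ he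
    exact hno _ E' hE' u v ⟨fun X σ c d _ _ h => h, fun f _ h => h⟩
  -- If `u` lay in the class of `a`, the edges `u → v` and `a → b` with the same label would fold,
  -- trading the new edge for `v = b`. The next three claims are the same for incoming edges and for
  -- two edges of `E`.
  have hDE_out : ∀ i u v a b, (a, some i, b) ∈ D → (u, some i, v) ∈ E →
      forcedClass D u ≠ forcedClass D (Sum.inl a) := by
    intro i u v a b hab he h
    obtain ⟨E', hE'⟩ := hsplit _ he
    refine hno _ E' hE' v (Sum.inl b) ⟨fun X σ c d hc _ hv => ?_, fun f _ hv => ?_⟩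
    · have h1 := elim_eq_of_forcedClass_eq h (d := d) hc
      have h2 := hc _ hab
      simp only [Sum.elim_inl] at h1 h2 hv ⊢
      rw [h1, hv, h2]
    · exact iff_of_true (extendTrue_of_forcedClass_eq_inl h f) (hv.2 trivial)
  have hDE_in : ∀ i u v a b, (a, some i, b) ∈ D → (u, some i, v) ∈ E →
      forcedClass D v ≠ forcedClass D (Sum.inl b) := by
    intro i u v a b hab he h
    obtain ⟨E', hE'⟩ := hsplit _ he
    refine hno _ E' hE' u (Sum.inl a) ⟨fun X σ c d hc _ hv => ?_, fun f _ hv => ?_⟩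
    · have h1 := elim_eq_of_forcedClass_eq h (d := d) hc
      have h2 := hc _ hab
      simp only [Sum.elim_inl] at h1 h2 hv ⊢
      rw [h1, hv, h2]
    · exact iff_of_true (hv.2 trivial) (extendTrue_of_forcedClass_eq_inl h f)
  have hEE_out : ∀ i u v u' v', (u, some i, v) ∈ E → (u', some i, v') ∈ E →
      forcedClass D u = forcedClass D u' → v = v' := by
    intro i u v u' v' he he' h
    by_contra hne
    obtain ⟨E', hE'⟩ := hsplit _ he
    have hmem : (u', some i, v') ∈ E' := by
      refine (List.mem_cons.1 (hE'.mem_iff.1 he')).resolve_left fun h' => hne ?_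
      simp only [Prod.mk.injEq] at h'
      simp only [h']
    refine hno _ E' hE' v v' ⟨fun X σ c d hc hc' hv => ?_, fun f hf hv => ?_⟩
    · have h1 := elim_eq_of_forcedClass_eq h (d := d) hc
      have h2 := hc' _ hmem
      simp only at h2 ⊢
      rw [h1, hv, h2]
    · have h1 := extendTrue_iff_of_forcedClass_eq h f
      have h2 := hf _ hmem
      simp only at h2 ⊢
      rw [h1, h2, hv]
  have hEE_in : ∀ i u v u' v', (u, some i, v) ∈ E → (u', some i, v') ∈ E →
      forcedClass D v = forcedClass D v' → u = u' := by
    intro i u v u' v' he he' h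
    by_contra hne
    obtain ⟨E', hE'⟩ := hsplit _ he
    have hmem : (u', some i, v') ∈ E' := by
      refine (List.mem_cons.1 (hE'.mem_iff.1 he')).resolve_left fun h' => hne ?_
      simp only [Prod.mk.injEq] at h'
      simp only [h']
    refine hno _ E' hE' u u' ⟨fun X σ c d hc hc' hv => ?_, fun f hf hv => ?_⟩
    · have h1 := elim_eq_of_forcedClass_eq h (d := d) hc
      have h2 := hc' _ hmem
      simp only at h2 ⊢
      rw [h1, hv, h2]
    · have h1 := extendTrue_iff_of_forcedClass_eq h f
      have h2 := hf _ hmem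
      simp only at h2 ⊢
      rw [h1, hv, h2]
  let r : ι → Quotient (forcedSetoid D) ⊕ B → Quotient (forcedSetoid D) ⊕ B → Prop :=
    fun i y y' => (∃ a b, (a, some i, b) ∈ D ∧ y = forcedClass D (Sum.inl a) ∧
      y' = forcedClass D (Sum.inl b)) ∨
      ∃ u v, (u, some i, v) ∈ E ∧ y = forcedClass D u ∧ y' = forcedClass D v
  have hext : ∀ i, ∃ τ : Equiv.Perm (Quotient (forcedSetoid D) ⊕ B), ∀ x y, r i x y → τ x = y := by
    intro i
    refine exists_perm_extending (r i) ?_ ?_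
    · rintro x y y' (⟨a, b, h, rfl, rfl⟩ | ⟨u, v, h, rfl, rfl⟩)
        (⟨a', b', h', h1, rfl⟩ | ⟨u', v', h', h1, rfl⟩)
      · refine congrArg Sum.inl (Quotient.sound ?_)
        intro X σ c hc
        -- Only vertices of `A` are compared, so the values on `B` are arbitrary; `c a` merely
        -- supplies a point of `X`.
        have h2 := elim_eq_of_forcedClass_eq h1 (d := fun _ => c a) hc
        have h3 := hc _ h
        have h4 := hc _ h'
        simp only [Sum.elim_inl] at h2 h3 h4
        rw [← h3, ← h4, h2]
      · exact (hDE_out i _ _ _ _ h h' h1.symm).elim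
      · exact (hDE_out i _ _ _ _ h' h h1).elim
      · rw [hEE_out i _ _ _ _ h h' h1]
    · rintro x x' y (⟨a, b, h, rfl, rfl⟩ | ⟨u, v, h, rfl, rfl⟩)
        (⟨a', b', h', rfl, h1⟩ | ⟨u', v', h', rfl, h1⟩)
      · refine congrArg Sum.inl (Quotient.sound ?_)
        intro X σ c hc
        have h2 := elim_eq_of_forcedClass_eq h1 (d := fun _ => c a) hc
        have h3 := hc _ h
        have h4 := hc _ h'
        simp only [Sum.elim_inl] at h2 h3 h4
        rw [← h3, ← h4] at h2
        exact (labelPerm σ (some i)).injective h2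
      · exact (hDE_in i _ _ _ _ h h' h1.symm).elim
      · exact (hDE_in i _ _ _ _ h' h h1).elim
      · rw [hEE_in i _ _ _ _ h h' h1]
  choose τ hτ using hext
  have hfix := hE _ τ (fun a => forcedClass D (Sum.inl a)) (fun b => forcedClass D (Sum.inr b)) ?_ ?_
  · intro X σ c hc i
    obtain ⟨a, ha⟩ := ho i
    have h1 : τ i (forcedClass D (Sum.inl o)) = forcedClass D (Sum.inl a) :=
      hτ i _ _ (Or.inl ⟨o, a, ha, rfl, rfl⟩)
    rw [hfix i] at h1
    have h2 := elim_eq_of_forcedClass_eq h1 (d := fun _ => c o) hc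
    have h3 := hc _ ha
    exact h3.trans h2.symm
  · rintro ⟨a, _ | i, b⟩ he
    · refine congrArg Sum.inl (Quotient.sound ?_)
      intro X σ c hc
      exact hc _ he
    · exact hτ i _ _ (Or.inl ⟨a, b, he, rfl, rfl⟩)
  · have hsum : Sum.elim (fun a => forcedClass D (Sum.inl a)) (fun b => forcedClass D (Sum.inr b)) =
        (forcedClass D : A ⊕ B → _) := by
      funext v; rcases v with a | b <;> rfl
    rw [hsum]
    rintro ⟨u, _ | i, v⟩ he
    · exact (hfold1 _ he rfl).elim
    · exact hτ i _ _ (Or.inr ⟨u, v, he, rfl, rfl⟩)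

/-- If a labelled graph, obtained from `D` by adding the edges `E` and the connected vertices `U`,
forces the base vertex to be fixed, then so do at most `|E| - |U|` identifications of vertices
of `D`. -/
theorem exists_identifications [Finite A] [Finite B] {o : A} :
    ∀ (E : List ((A ⊕ B) × Option ι × (A ⊕ B))) (D : Set (A × Option ι × A)) (U : Finset B),
      (∀ i, ∃ a, (o, some i, a) ∈ D) → ForcesFixedRel D o E → ConnectedTo E U →
      ∃ T : List (A × A), T.length + U.card ≤ E.length ∧
        ForcesFixed (D ∪ identEdges T) o := by
  classical
  intro E
  induction hN : E.length generalizing E with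
  | zero =>
    intro D U ho hE hU
    obtain rfl := List.length_eq_zero_iff.1 hN
    refine ⟨[], by simpa using hU.card_le, ?_⟩
    have := forcesFixed_of_no_fold ho hE fun e E' h => by simpa using h.length_eq
    simpa [identEdges] using this
  | succ N ih =>
    intro D U ho hE hU
    by_cases hfold : ∃ e E', E.Perm (e :: E') ∧ ∃ x y, FoldsTo D E' e x y
    · obtain ⟨e, E', he, x, y, hxy⟩ := hfold
      have hperm : ∀ e' ∈ E, e' = e ∨ e' ∈ E' := fun e' he' =>
        List.mem_cons.1 (he.mem_iff.1 he')
      have hlen : E'.length = N := by simpa [hN] using he.length_eq.symm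
      have hE' : ForcesFixedRel D o ((x, none, y) :: E') := by
        intro X σ c d hc hc'
        have h1 : RespectsEdges σ (Sum.elim c d) {e | e ∈ E'} :=
          fun e he => hc' e (List.mem_cons_of_mem _ he)
        refine hE X σ c d hc fun e' he' => ?_
        rcases hperm e' he' with rfl | he'
        · exact hxy.1 X σ c d hc h1 (hc' (x, none, y) (List.mem_cons_self ..))
        · exact h1 e' he'
      have hU' : ConnectedTo (((x, none, y) : (A ⊕ B) × Option ι × (A ⊕ B)) :: E') U := by
        intro f hf
        have h1 : ∀ e ∈ E', (extendTrue f e.1 ↔ extendTrue f e.2.2) :=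
          fun e he => hf e (List.mem_cons_of_mem _ he)
        refine hU f fun e' he' => ?_
        rcases hperm e' he' with rfl | he'
        · exact hxy.2 f h1 (hf (x, none, y) (List.mem_cons_self ..))
        · exact h1 e' he'
      -- An identification involving a vertex of `B` is contracted: the loss of an edge pays for the
      -- loss of a vertex, and nothing is recorded.
      have key : ∀ j z, (x = Sum.inr j ∧ y = z ∨ x = z ∧ y = Sum.inr j) →
          ∃ T : List (A × A), T.length + U.card ≤ N + 1 ∧ ForcesFixed (D ∪ identEdges T) o := by
        intro j z hz
        obtain ⟨T, hT, hT'⟩ := ih (E'.map (substEdge j z)) (by simpa using hlen) D (U.erase j) ho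
          (hE'.subst hz) (hU'.subst hz)
        have := Finset.pred_card_le_card_erase (s := U) (a := j)
        exact ⟨T, by omega, hT'⟩
      rcases x with a | j
      · rcases y with b | j
        -- Both ends are old: the identification moves into `D` and is recorded in `T`, paid for by
        -- the lost edge.
        · have hE'' : ForcesFixedRel (D ∪ {(a, none, b)}) o E' := by
            intro X σ c d hc hc'
            refine hE' X σ c d (fun e he => hc e (Or.inl he)) fun e he => ?_
            rcases List.mem_cons.1 he with rfl | he
            · exact hc (a, none, b) (Or.inr rfl)
            · exact hc' e he
          have hU'' : ConnectedTo E' U := by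
            intro f hf
            refine hU' f fun e he => ?_
            rcases List.mem_cons.1 he with rfl | he
            · exact Iff.rfl
            · exact hf e he
          obtain ⟨T, hT, hT'⟩ := ih E' hlen (D ∪ {(a, none, b)}) U
            (fun i => (ho i).imp fun _ h => Or.inl h) hE'' hU''
          refine ⟨(a, b) :: T, by simp only [List.length_cons]; omega, ?_⟩
          have : D ∪ identEdges ((a, b) :: T) = D ∪ {(a, none, b)} ∪ identEdges T := by
            ext e; simp [identEdges, or_assoc, or_left_comm]
          rw [this]; exact hT'
        · exact key j _ (Or.inr ⟨rfl, rfl⟩)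
      · exact key j _ (Or.inl ⟨rfl, rfl⟩)
    -- Nothing folds, so no identification is needed; connectedness supplies the bound on `U`.
    · push Not at hfold
      refine ⟨[], by have := hU.card_le; simp only [List.length_nil]; omega, ?_⟩
      have := forcesFixed_of_no_fold ho hE hfold
      simpa [identEdges] using this

end Folding

/-! ### The graph of suffixes of the given words, and petals for further generators. -/

section WordGraph

/-- The value in the free group of rank `n` of a letter written with a natural number. -/
def natLetter (n : ℕ) (x : ℕ × Bool) : FreeGroup (Fin n) :=
  if h : x.1 < n then (if x.2 then FreeGroup.of ⟨x.1, h⟩ else (FreeGroup.of ⟨x.1, h⟩)⁻¹) else 1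

/-- The value in the free group of rank `n` of a word written with natural numbers. -/
def natWord (n : ℕ) (w : List (ℕ × Bool)) : FreeGroup (Fin n) :=
  (w.map (natLetter n)).prod

theorem natWord_nil (n : ℕ) : natWord n [] = 1 := rfl

theorem natWord_cons (n : ℕ) (x : ℕ × Bool) (w : List (ℕ × Bool)) :
    natWord n (x :: w) = natLetter n x * natWord n w := by simp [natWord]

theorem natLetter_true {n : ℕ} (i : Fin n) : natLetter n (i, true) = FreeGroup.of i := by
  simp [natLetter]

theorem natLetter_false {n : ℕ} (i : Fin n) : natLetter n (i, false) = (FreeGroup.of i)⁻¹ := by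
  simp [natLetter]

theorem natWord_map_val {n : ℕ} (w : List (Fin n × Bool)) :
    natWord n (w.map fun x => ((x.1 : ℕ), x.2)) = FreeGroup.mk w := by
  induction w with
  | nil => rfl
  | cons x w ih =>
    rw [List.map_cons, natWord_cons, ih, ← List.singleton_append, ← FreeGroup.mul_mk]
    congr 1
    obtain ⟨i, _ | _⟩ := x
    · exact natLetter_false i
    · exact natLetter_true i

/-- Multiplication by the letter `i` on the left takes `p` to `q`, without cancellation in one of
the two directions. -/
def WordStep (i : ℕ) (p q : List (ℕ × Bool)) : Prop :=
  q = (i, true) :: p ∨ p = (i, false) :: q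

/-- The empty word, the letters, and all suffixes of the words in `W`. -/
def vertexWords (n : ℕ) (W : List (List (ℕ × Bool))) : List (List (ℕ × Bool)) :=
  [] :: ((List.range n).map (fun i => [(i, true)]) ++ W.flatMap List.tails)

theorem nil_mem_vertexWords (n : ℕ) (W : List (List (ℕ × Bool))) : [] ∈ vertexWords n W := by
  simp [vertexWords]

theorem letter_mem_vertexWords {n : ℕ} (W : List (List (ℕ × Bool))) {i : ℕ} (hi : i < n) :
    [(i, true)] ∈ vertexWords n W := by
  simp [vertexWords, hi]

theorem mem_vertexWords_of_mem {n : ℕ} {W : List (List (ℕ × Bool))} {w : List (ℕ × Bool)}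
    (hw : w ∈ W) : w ∈ vertexWords n W := by
  simp only [vertexWords, List.mem_cons, List.mem_append, List.mem_flatMap, List.mem_tails]
  exact Or.inr (Or.inr ⟨w, hw, List.suffix_rfl⟩)

theorem vertexWords_of_cons {n : ℕ} {W : List (List (ℕ × Bool))}
    (hW : ∀ w ∈ W, ∀ x ∈ w, x.1 < n) {x : ℕ × Bool} {p : List (ℕ × Bool)}
    (h : x :: p ∈ vertexWords n W) : x.1 < n ∧ p ∈ vertexWords n W := by
  simp only [vertexWords, List.mem_cons, List.mem_append, List.mem_flatMap, List.mem_tails,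
    List.mem_map, List.mem_range] at h ⊢
  rcases h with h | ⟨i, hi, h⟩ | ⟨w, hw, h⟩
  · cases h
  · cases h
    exact ⟨hi, Or.inl rfl⟩
  · exact ⟨hW w hw x (h.subset List.mem_cons_self),
      Or.inr (Or.inr ⟨w, hw, (List.suffix_cons x p).trans h⟩)⟩

/-- The vertices of the word graph. -/
abbrev Vertex (n : ℕ) (W : List (List (ℕ × Bool))) : Type := {p // p ∈ vertexWords n W}

/-- The vertex given by the empty word. -/
def baseVertex (n : ℕ) (W : List (List (ℕ × Bool))) : Vertex n W := ⟨[], nil_mem_vertexWords n W⟩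

/-- The edges between the vertex words given by letters, together with the identifications of the
words in `W` with the empty word. -/
def wordEdges (n : ℕ) (W : List (List (ℕ × Bool))) :
    Set (Vertex n W × Option (Fin n) × Vertex n W) :=
  {e | (∃ i, e.2.1 = some i ∧ WordStep i e.1.1 e.2.2.1) ∨
    e.2.1 = none ∧ e.1.1 ∈ W ∧ e.2.2.1 = []}

/-- The identifications of vertex words listed in `T`. -/
def pairEdges {n : ℕ} {W : List (List (ℕ × Bool))}
    (T : List (List (ℕ × Bool) × List (ℕ × Bool))) :
    Set (Vertex n W × Option (Fin n) × Vertex n W) :=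
  {e | e.2.1 = none ∧ (e.1.1, e.2.2.1) ∈ T}

/-- The identifications `T` together with the words `W` generate the free group. -/
def ForcesAll (n : ℕ) (W : List (List (ℕ × Bool)))
    (T : List (List (ℕ × Bool) × List (ℕ × Bool))) : Prop :=
  ForcesFixed (wordEdges n W ∪ pairEdges T) (baseVertex n W)

/-- The generators given by words and identifications. -/
def pairGenerators (n : ℕ) (T : List (List (ℕ × Bool) × List (ℕ × Bool))) :
    Set (FreeGroup (Fin n)) :=
  {g | ∃ t ∈ T, (natWord n t.2)⁻¹ * natWord n t.1 = g}

/-- The elements represented by a list of words. -/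
def wordGenerators (n : ℕ) (W : List (List (ℕ × Bool))) : Set (FreeGroup (Fin n)) :=
  {g | ∃ w ∈ W, natWord n w = g}

theorem RespectsEdges.mono {ι V X : Type*} {σ : ι → Equiv.Perm X} {c : V → X}
    {D D' : Set (V × Option ι × V)} (h : RespectsEdges σ c D') (hD : D ⊆ D') :
    RespectsEdges σ c D := fun e he => h e (hD he)

/-- Each suffix is joined by an edge to the next shorter one, so the image of the base vertex
determines all others. -/
theorem RespectsEdges.eq_lift {n : ℕ} {W : List (List (ℕ × Bool))}
    (hW : ∀ w ∈ W, ∀ x ∈ w, x.1 < n) {X : Type} {σ : Fin n → Equiv.Perm X} {c : Vertex n W → X}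
    (hc : RespectsEdges σ c (wordEdges n W)) :
    ∀ (p : List (ℕ × Bool)) (hp : p ∈ vertexWords n W),
      c ⟨p, hp⟩ = FreeGroup.lift σ (natWord n p) (c (baseVertex n W)) := by
  intro p
  induction p with
  | nil => intro hp; simp [natWord_nil, baseVertex]
  | cons x p ih =>
    intro hp
    obtain ⟨hx, hp'⟩ := vertexWords_of_cons hW hp
    obtain ⟨i, b⟩ := x
    rw [natWord_cons, map_mul, Equiv.Perm.mul_apply, ← ih hp']
    lift i to Fin n using hx
    cases b
    · have := hc (⟨_, hp⟩, some i, ⟨_, hp'⟩) (Or.inl ⟨i, rfl, Or.inr rfl⟩)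
      rw [natLetter_false, map_inv, FreeGroup.lift_apply_of, Equiv.Perm.eq_inv_iff_eq]
      exact this
    · have := hc (⟨_, hp'⟩, some i, ⟨_, hp⟩) (Or.inl ⟨i, rfl, Or.inl rfl⟩)
      rw [natLetter_true, FreeGroup.lift_apply_of]
      exact this.symm

theorem natWord_mem_stabilizer {n : ℕ} {W : List (List (ℕ × Bool))}
    (hW : ∀ w ∈ W, ∀ x ∈ w, x.1 < n) {X : Type} {σ : Fin n → Equiv.Perm X} {c : Vertex n W → X}
    (hc : RespectsEdges σ c (wordEdges n W)) {w : List (ℕ × Bool)} (hw : w ∈ W) :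
    FreeGroup.lift σ (natWord n w) (c (baseVertex n W)) = c (baseVertex n W) := by
  rw [← hc.eq_lift hW w (mem_vertexWords_of_mem hw)]
  exact hc (⟨w, mem_vertexWords_of_mem hw⟩, none, baseVertex n W) (Or.inr ⟨rfl, hw, rfl⟩)

theorem fixed_of_closure_eq_top {n : ℕ} {X : Type} {σ : Fin n → Equiv.Perm X} {x : X}
    {S : Set (FreeGroup (Fin n))} (hS : Subgroup.closure S = ⊤)
    (h : ∀ g ∈ S, FreeGroup.lift σ g x = x) (i : Fin n) : σ i x = x := by
  have hle : Subgroup.closure S ≤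
      (MulAction.stabilizer (Equiv.Perm X) x).comap (FreeGroup.lift σ) :=
    (Subgroup.closure_le _).2 fun g hg => h g hg
  have := hle (hS ▸ Subgroup.mem_top (FreeGroup.of i))
  simpa [Subgroup.mem_comap, MulAction.mem_stabilizer_iff] using this

/-- One direction tests the graph on the cosets of the generated subgroup; the other observes that
all generators stabilize the image of the base vertex. -/
theorem forcesAll_iff {n : ℕ} {W : List (List (ℕ × Bool))}
    (hW : ∀ w ∈ W, ∀ x ∈ w, x.1 < n) {T : List (List (ℕ × Bool) × List (ℕ × Bool))}
    (hT : ∀ t ∈ T, t.1 ∈ vertexWords n W ∧ t.2 ∈ vertexWords n W) :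
    ForcesAll n W T ↔
      Subgroup.closure (wordGenerators n W ∪ pairGenerators n T) = ⊤ := by
  constructor
  · intro h
    set H := Subgroup.closure (wordGenerators n W ∪ pairGenerators n T) with hH
    have key := h (FreeGroup (Fin n) ⧸ H) (fun i => MulAction.toPerm (FreeGroup.of i))
      (fun p => (natWord n p.1 : FreeGroup (Fin n) ⧸ H)) ?_
    · rw [eq_top_iff, ← FreeGroup.closure_range_of, Subgroup.closure_le]
      rintro _ ⟨i, rfl⟩
      -- The trivial coset is fixed by the letter `i`, that is, the letter lies in `H`.
      have h1 := key i
      simp only [baseVertex, natWord_nil, MulAction.toPerm_apply] at h1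
      rwa [MulAction.Quotient.smul_coe, eq_comm, QuotientGroup.eq, inv_one, one_mul, smul_eq_mul,
        mul_one] at h1
    · rintro ⟨p, l, q⟩ ((⟨i, hl, hpq⟩ | ⟨hl, hp, hq⟩) | ⟨hl, hpq⟩)
      · simp only at hl hpq
        subst hl
        change ((FreeGroup.of i • natWord n p.1 : FreeGroup (Fin n)) : FreeGroup (Fin n) ⧸ H) =
          natWord n q.1
        rcases hpq with h1 | h1
        · rw [h1, natWord_cons, natLetter_true]; rfl
        · rw [h1, natWord_cons, natLetter_false, smul_eq_mul, mul_inv_cancel_left]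
      · simp only at hl hp hq
        subst hl
        change (natWord n p.1 : FreeGroup (Fin n) ⧸ H) = natWord n q.1
        rw [hq, natWord_nil, eq_comm, QuotientGroup.eq, inv_one, one_mul]
        exact Subgroup.subset_closure (Or.inl ⟨_, hp, rfl⟩)
      · simp only at hl hpq
        subst hl
        change (natWord n p.1 : FreeGroup (Fin n) ⧸ H) = natWord n q.1
        rw [eq_comm, QuotientGroup.eq]
        exact Subgroup.subset_closure (Or.inr ⟨_, hpq, rfl⟩)
  · intro h X σ c hc i
    have hc1 : RespectsEdges σ c (wordEdges n W) := hc.mono Set.subset_union_left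
    refine fixed_of_closure_eq_top h ?_ i
    rintro _ (⟨w, hw, rfl⟩ | ⟨t, ht, rfl⟩)
    · exact natWord_mem_stabilizer hW hc1 hw
    · have h1 := hc (⟨t.1, (hT t ht).1⟩, none, ⟨t.2, (hT t ht).2⟩) (Or.inr ⟨rfl, ht⟩)
      rw [map_mul, Equiv.Perm.mul_apply, map_inv, Equiv.Perm.inv_eq_iff_eq,
        ← hc1.eq_lift hW _ (hT t ht).1, ← hc1.eq_lift hW _ (hT t ht).2]
      exact h1

/-- The suffixes of the reduced words of the elements of `L`. -/
abbrev Petal {n : ℕ} (L : List (FreeGroup (Fin n))) : Type :=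
  {b : List (Fin n × Bool) // ∃ t ∈ L, b <:+ t.toWord}

instance {n : ℕ} (L : List (FreeGroup (Fin n))) : Finite (Petal L) := by
  refine Set.Finite.subset (List.finite_toSet (L.flatMap fun t => t.toWord.tails)) ?_
  rintro b ⟨t, ht, hb⟩
  exact List.mem_flatMap.2 ⟨t, ht, (List.mem_tails ..).2 hb⟩

theorem petal_of_cons {n : ℕ} {L : List (FreeGroup (Fin n))} {x : Fin n × Bool}
    {b : List (Fin n × Bool)} (h : ∃ t ∈ L, (x :: b) <:+ t.toWord) : ∃ t ∈ L, b <:+ t.toWord :=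
  h.imp fun _ ht => ⟨ht.1, (List.suffix_cons x b).trans ht.2⟩

/-- The edge joining a suffix to the next shorter one, or the empty word to the vertex `o`. -/
def petalEdge {n : ℕ} {A : Type} (o : A) (L : List (FreeGroup (Fin n))) :
    Petal L → (A ⊕ Petal L) × Option (Fin n) × (A ⊕ Petal L)
  | ⟨[], h⟩ => (Sum.inr ⟨[], h⟩, none, Sum.inl o)
  | ⟨(i, true) :: b, h⟩ =>
    (Sum.inr ⟨b, petal_of_cons h⟩, some i, Sum.inr ⟨(i, true) :: b, h⟩)
  | ⟨(i, false) :: b, h⟩ =>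
    (Sum.inr ⟨(i, false) :: b, h⟩, some i, Sum.inr ⟨b, petal_of_cons h⟩)

/-- The petals attached at `o` whose labels are the reduced words of the elements of `L`. -/
noncomputable def petalEdges {n : ℕ} {A : Type} (o : A) (L : List (FreeGroup (Fin n)))
    [Fintype (Petal L)] : List ((A ⊕ Petal L) × Option (Fin n) × (A ⊕ Petal L)) :=
  (Finset.univ : Finset (Petal L)).toList.map (petalEdge o L) ++
    L.attach.map fun t => (Sum.inr ⟨t.1.toWord, t.1, t.2, List.suffix_rfl⟩, none, Sum.inl o)

theorem petalEdge_mem {n : ℕ} {A : Type} (o : A) (L : List (FreeGroup (Fin n)))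
    [Fintype (Petal L)] (b : Petal L) : petalEdge o L b ∈ petalEdges o L :=
  List.mem_append_left _ (List.mem_map_of_mem (Finset.mem_toList.2 (Finset.mem_univ b)))

theorem connectedTo_petalEdges {n : ℕ} {A : Type} (o : A) (L : List (FreeGroup (Fin n)))
    [Fintype (Petal L)] : ConnectedTo (petalEdges o L) Finset.univ := by
  rintro f hf ⟨b, hb⟩ -
  induction b with
  | nil => exact (hf _ (petalEdge_mem o L ⟨[], hb⟩)).2 trivial
  | cons x b ih =>
    have h := hf _ (petalEdge_mem o L ⟨x :: b, hb⟩)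
    obtain ⟨i, _ | _⟩ := x
    · exact h.2 (ih _)
    · exact h.1 (ih _)

theorem petalEdges_eq_lift {n : ℕ} {A X : Type} {o : A} {L : List (FreeGroup (Fin n))}
    [Fintype (Petal L)] {σ : Fin n → Equiv.Perm X} {c : A → X} {d : Petal L → X}
    (h : RespectsEdges σ (Sum.elim c d) {e | e ∈ petalEdges o L}) (b : List (Fin n × Bool))
    (hb : ∃ t ∈ L, b <:+ t.toWord) :
    d ⟨b, hb⟩ = FreeGroup.lift σ (FreeGroup.mk b) (c o) := by
  induction b with
  | nil =>
    rw [← FreeGroup.one_eq_mk, map_one]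
    exact h _ (petalEdge_mem o L ⟨[], hb⟩)
  | cons x b ih =>
    have h1 := h _ (petalEdge_mem o L ⟨x :: b, hb⟩)
    have h2 : FreeGroup.mk (x :: b) = FreeGroup.mk [x] * FreeGroup.mk b := by
      rw [FreeGroup.mul_mk, List.singleton_append]
    rw [h2, map_mul, Equiv.Perm.mul_apply, ← ih (petal_of_cons hb)]
    obtain ⟨i, _ | _⟩ := x
    · change _ = FreeGroup.lift σ (FreeGroup.of i)⁻¹ _
      rw [map_inv, FreeGroup.lift_apply_of, Equiv.Perm.eq_inv_iff_eq]
      exact h1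
    · change _ = FreeGroup.lift σ (FreeGroup.of i) _
      rw [FreeGroup.lift_apply_of]
      exact h1.symm

theorem exists_forcesAll_of_closure_eq_top {n : ℕ} {W : List (List (ℕ × Bool))}
    (hW : ∀ w ∈ W, ∀ x ∈ w, x.1 < n) (L : List (FreeGroup (Fin n)))
    (hL : Subgroup.closure (wordGenerators n W ∪ {g | g ∈ L}) = ⊤) :
    ∃ T : List (List (ℕ × Bool) × List (ℕ × Bool)), T.length ≤ L.length ∧
      (∀ t ∈ T, t.1 ∈ vertexWords n W ∧ t.2 ∈ vertexWords n W) ∧ ForcesAll n W T := by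
  cases nonempty_fintype (Petal L)
  -- Here the one-letter words are needed as vertices, even for letters that do not occur in `W`.
  have ho : ∀ i, ∃ a, (baseVertex n W, some i, a) ∈ wordEdges n W :=
    fun i => ⟨⟨_, letter_mem_vertexWords W i.2⟩, Or.inl ⟨i, rfl, Or.inl rfl⟩⟩
  have hforces : ForcesFixedRel (wordEdges n W) (baseVertex n W)
      (petalEdges (baseVertex n W) L) := by
    intro X σ c d hc hd i
    refine fixed_of_closure_eq_top hL ?_ i
    rintro g (⟨w, hw, rfl⟩ | hg)
    · exact natWord_mem_stabilizer hW hc hw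
    · have h1 := petalEdges_eq_lift hd g.toWord ⟨g, hg, List.suffix_rfl⟩
      rw [FreeGroup.mk_toWord] at h1
      rw [← h1]
      exact hd (Sum.inr ⟨g.toWord, g, hg, List.suffix_rfl⟩, none, Sum.inl (baseVertex n W))
        (List.mem_append_right _ (List.mem_map.2 ⟨⟨g, hg⟩, List.mem_attach _ _, rfl⟩))
  obtain ⟨T, hlen, hT⟩ := exists_identifications _ _ Finset.univ ho hforces
    (connectedTo_petalEdges _ L)
  refine ⟨T.map fun t => (t.1.1, t.2.1), ?_, ?_, ?_⟩
  -- Every petal vertex has one edge towards the base, and every element of `L` adds one closing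
  -- edge; the excess is `L.length`.
  · have : T.length + Fintype.card (Petal L) ≤ Fintype.card (Petal L) + L.length := by
      simpa [petalEdges] using hlen
    simp only [List.length_map]
    omega
  · simp only [List.mem_map]
    rintro _ ⟨t, -, rfl⟩
    exact ⟨t.1.2, t.2.2⟩
  · have : (pairEdges (T.map fun t => (t.1.1, t.2.1)) :
        Set (Vertex n W × Option (Fin n) × Vertex n W)) = identEdges T := by
      ext ⟨p, l, q⟩
      simp only [pairEdges, identEdges, Set.mem_ofPred_eq, List.mem_map, Prod.mk.injEq]
      constructor
      · rintro ⟨rfl, t, ht, h1, h2⟩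
        exact ⟨t, ht, Subtype.ext h1.symm, rfl, Subtype.ext h2.symm⟩
      · rintro ⟨t, ht, rfl, rfl, rfl⟩
        exact ⟨rfl, t, ht, rfl, rfl⟩
    rw [ForcesAll, this]
    exact hT

end WordGraph

/-! ### A finite test for sufficiency, and the search for the minimum. -/

section Algorithm

/-- All pairs of elements of a list. -/
def listPairs {α : Type*} (P : List α) : List (α × α) :=
  P.flatMap fun x => P.map fun y => (x, y)

theorem mem_listPairs {α : Type*} {P : List α} {t : α × α} :
    t ∈ listPairs P ↔ t.1 ∈ P ∧ t.2 ∈ P := by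
  obtain ⟨x, y⟩ := t
  simp [listPairs]

/-- `R` is an equivalence relation on the vertex words that is compatible with multiplication by
letters and relates all words in `W` to the empty word. -/
def IsClosedRel (n : ℕ) (W : List (List (ℕ × Bool)))
    (R : List (List (ℕ × Bool) × List (ℕ × Bool))) : Prop :=
  (∀ x ∈ vertexWords n W, (x, x) ∈ R) ∧
  (∀ x ∈ vertexWords n W, ∀ y ∈ vertexWords n W, ∀ z ∈ vertexWords n W,
    (x, y) ∈ R → (x, z) ∈ R → (y, z) ∈ R) ∧
  (∀ i ∈ List.range n, ∀ x ∈ vertexWords n W, ∀ y ∈ vertexWords n W, ∀ x' ∈ vertexWords n W,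
    ∀ y' ∈ vertexWords n W, WordStep i x x' → WordStep i y y' → ((x, y) ∈ R ↔ (x', y') ∈ R)) ∧
  ∀ w ∈ W, (w, []) ∈ R

/-- Every closed relation containing the identifications `T` relates all letters to the empty
word. -/
def IsSpanning (n : ℕ) (W : List (List (ℕ × Bool)))
    (T : List (List (ℕ × Bool) × List (ℕ × Bool))) : Prop :=
  ∀ R ∈ (listPairs (vertexWords n W)).sublists', IsClosedRel n W R → (∀ t ∈ T, t ∈ R) →
    ∀ i ∈ List.range n, ([(i, true)], []) ∈ R

/-- Two words are related when `c` gives them the same image; this relation is closed because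
letters act injectively. -/
theorem IsSpanning.forcesAll {n : ℕ} {W : List (List (ℕ × Bool))}
    {T : List (List (ℕ × Bool) × List (ℕ × Bool))}
    (hT : ∀ t ∈ T, t.1 ∈ vertexWords n W ∧ t.2 ∈ vertexWords n W) (h : IsSpanning n W T) :
    ForcesAll n W T := by
  classical
  intro X σ c hc i
  let R := (listPairs (vertexWords n W)).filter
    fun t => ∃ (h1 : t.1 ∈ vertexWords n W) (h2 : t.2 ∈ vertexWords n W), c ⟨t.1, h1⟩ = c ⟨t.2, h2⟩
  have hR : ∀ p q, (p, q) ∈ R ↔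
      ∃ (h1 : p ∈ vertexWords n W) (h2 : q ∈ vertexWords n W), c ⟨p, h1⟩ = c ⟨q, h2⟩ := by
    intro p q
    simp only [R, List.mem_filter, mem_listPairs, decide_eq_true_eq]
    exact ⟨fun h => h.2, fun h => ⟨⟨h.1, h.2.1⟩, h⟩⟩
  have hstep : ∀ (i : Fin n) (p q : Vertex n W), WordStep i p.1 q.1 → σ i (c p) = c q :=
    fun i p q hpq => hc (p, some i, q) (Or.inl (Or.inl ⟨i, rfl, hpq⟩))
  have hmem := h R (List.mem_sublists'.2 List.filter_sublist) ?_ ?_ i (List.mem_range.2 i.2)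
  · obtain ⟨h1, h2, h3⟩ := (hR _ _).1 hmem
    exact (hstep i (baseVertex n W) ⟨_, h1⟩ (Or.inl rfl)).trans h3
  · refine ⟨fun x hx => (hR _ _).2 ⟨hx, hx, rfl⟩, ?_, ?_, ?_⟩
    · intro x hx y hy z hz hxy hxz
      obtain ⟨_, _, h1⟩ := (hR _ _).1 hxy
      obtain ⟨_, _, h2⟩ := (hR _ _).1 hxz
      exact (hR _ _).2 ⟨hy, hz, h1.symm.trans h2⟩
    · intro j hj x hx y hy x' hx' y' hy' h1 h2
      have h3 := hstep ⟨j, List.mem_range.1 hj⟩ ⟨x, hx⟩ ⟨x', hx'⟩ h1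
      have h4 := hstep ⟨j, List.mem_range.1 hj⟩ ⟨y, hy⟩ ⟨y', hy'⟩ h2
      rw [hR, hR]
      constructor
      · rintro ⟨_, _, h5⟩
        exact ⟨hx', hy', by rw [← h3, ← h4, h5]⟩
      · rintro ⟨_, _, h5⟩
        exact ⟨hx, hy, (σ _).injective (by rw [h3, h4, h5])⟩
    · intro w hw
      exact (hR _ _).2 ⟨mem_vertexWords_of_mem hw, nil_mem_vertexWords n W,
        hc (⟨w, mem_vertexWords_of_mem hw⟩, none, baseVertex n W) (Or.inl (Or.inr ⟨rfl, hw, rfl⟩))⟩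
  · intro t ht
    exact (hR _ _).2 ⟨(hT t ht).1, (hT t ht).2,
      hc (⟨t.1, (hT t ht).1⟩, none, ⟨t.2, (hT t ht).2⟩) (Or.inr ⟨rfl, ht⟩)⟩

/-- On the quotient by a closed relation letters are partial injections; extending them to
permutations gives an action to which the forcing applies. -/
theorem ForcesAll.isSpanning {n : ℕ} {W : List (List (ℕ × Bool))}
    {T : List (List (ℕ × Bool) × List (ℕ × Bool))} (h : ForcesAll n W T) : IsSpanning n W T := by
  rintro R - ⟨hrefl, htrans, hfold, hW⟩ hT i hi
  lift i to Fin n using List.mem_range.1 hi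
  -- The Euclidean law in `IsClosedRel` yields symmetry and transitivity with the help of
  -- reflexivity.
  let s : Setoid (Vertex n W) :=
    { r := fun p q => (p.1, q.1) ∈ R
      iseqv := ⟨fun p => hrefl _ p.2,
        fun {p q} hpq => htrans _ p.2 _ q.2 _ p.2 hpq (hrefl _ p.2),
        fun {p q r} hpq hqr => htrans _ q.2 _ p.2 _ r.2
          (htrans _ p.2 _ q.2 _ p.2 hpq (hrefl _ p.2)) hqr⟩ }
  have : Finite (Vertex n W) := List.finite_toSet (vertexWords n W)
  have hext : ∀ i : Fin n, ∃ τ : Equiv.Perm (Quotient s), ∀ x y,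
      (∃ p q : Vertex n W, WordStep i p.1 q.1 ∧ x = Quotient.mk s p ∧ y = Quotient.mk s q) →
        τ x = y := by
    intro i
    refine exists_perm_extending _ ?_ ?_
    · rintro x y y' ⟨p, q, hpq, rfl, rfl⟩ ⟨p', q', hpq', h1, rfl⟩
      exact Quotient.sound ((hfold i (List.mem_range.2 i.2) _ p.2 _ p'.2 _ q.2 _ q'.2 hpq hpq').1
        (Quotient.exact h1))
    · rintro x x' y ⟨p, q, hpq, rfl, rfl⟩ ⟨p', q', hpq', rfl, h1⟩
      exact Quotient.sound ((hfold i (List.mem_range.2 i.2) _ p.2 _ p'.2 _ q.2 _ q'.2 hpq hpq').2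
        (Quotient.exact h1))
  choose τ hτ using hext
  have hfix := h _ τ (Quotient.mk s) ?_ i
  · rw [hτ i _ _ ⟨baseVertex n W, ⟨_, letter_mem_vertexWords W i.2⟩, Or.inl rfl, rfl, rfl⟩] at hfix
    exact Quotient.exact hfix
  · rintro ⟨p, l, q⟩ ((⟨i, hl, hpq⟩ | ⟨hl, hp, hq⟩) | ⟨hl, hpq⟩)
    · simp only at hl; subst hl
      exact hτ i _ _ ⟨p, q, hpq, rfl, rfl⟩
    · simp only at hl hq; subst hl
      refine Quotient.sound (?_ : (p.1, q.1) ∈ R)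
      rw [hq]
      exact hW _ hp
    · simp only at hl; subst hl
      exact Quotient.sound (hT _ hpq)

open Classical in
/-- The least length of a spanning list of identifications, if it is less than `n`. -/
noncomputable def corankOfWords (a : ℕ × List (List (ℕ × Bool))) : ℕ :=
  (listPairs (vertexWords a.1 a.2)).sublists'.foldr
    (fun T r => if IsSpanning a.1 a.2 T ∧ T.length < r then T.length else r) a.1

open Classical in
theorem foldr_min_length {α : Type*} (p : List α → Prop) (n : ℕ) (L : List (List α)) :
    let r := L.foldr (fun T r => if p T ∧ T.length < r then T.length else r) n
    r ≤ n ∧ (∀ T ∈ L, p T → r ≤ T.length) ∧ (r = n ∨ ∃ T ∈ L, p T ∧ T.length = r) := by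
  induction L with
  | nil => simp
  | cons T L ih =>
    obtain ⟨h1, h2, h3⟩ := ih
    simp only [List.foldr_cons]
    generalize L.foldr (fun T r => if p T ∧ T.length < r then T.length else r) n = r at *
    split_ifs with h
    · refine ⟨by omega, ?_, Or.inr ⟨T, List.mem_cons_self, h.1, rfl⟩⟩
      intro T' hT' hp
      rcases List.mem_cons.1 hT' with rfl | hT'
      · exact le_rfl
      · have := h2 T' hT' hp
        omega
    · refine ⟨h1, ?_, ?_⟩
      · intro T' hT' hp
        rcases List.mem_cons.1 hT' with rfl | hT'
        · by_contra hlt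
          exact h ⟨hp, by omega⟩
        · exact h2 T' hT' hp
      · rcases h3 with h3 | ⟨T', hT', h3⟩
        · exact Or.inl h3
        · exact Or.inr ⟨T', List.mem_cons_of_mem _ hT', h3⟩

/-- The search sees only sublists of the list of pairs. Removing repetitions from `T` and reordering
it does not affect spanning and does not increase its length. -/
theorem corankOfWords_le_length {n : ℕ} {W : List (List (ℕ × Bool))}
    {T : List (List (ℕ × Bool) × List (ℕ × Bool))}
    (hT : ∀ t ∈ T, t.1 ∈ vertexWords n W ∧ t.2 ∈ vertexWords n W) (h : ForcesAll n W T) :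
    corankOfWords (n, W) ≤ T.length := by
  classical
  obtain ⟨T', hperm, hsub⟩ : T.dedup.Subperm (listPairs (vertexWords n W)) :=
    List.subperm_of_subset (List.nodup_dedup T)
      fun t ht => mem_listPairs.2 (hT t (List.mem_dedup.1 ht))
  have hmem : ∀ t, t ∈ T' ↔ t ∈ T := fun t => hperm.mem_iff.trans List.mem_dedup
  have hspan : IsSpanning n W T' := fun R hR hcl hT' =>
    h.isSpanning R hR hcl fun t ht => hT' t ((hmem t).2 ht)
  calc corankOfWords (n, W) ≤ T'.length :=
        (foldr_min_length _ _ _).2.1 T' (List.mem_sublists'.2 hsub) hspan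
    _ = T.dedup.length := hperm.length_eq
    _ ≤ T.length := (List.dedup_sublist T).length_le

theorem corankOfWords_attained (n : ℕ) (W : List (List (ℕ × Bool))) :
    corankOfWords (n, W) = n ∨ ∃ T : List (List (ℕ × Bool) × List (ℕ × Bool)),
      (∀ t ∈ T, t.1 ∈ vertexWords n W ∧ t.2 ∈ vertexWords n W) ∧ ForcesAll n W T ∧
        T.length = corankOfWords (n, W) := by
  refine (foldr_min_length (IsSpanning n W) n
    (listPairs (vertexWords n W)).sublists').2.2.imp id ?_
  rintro ⟨T, hT, hspan, hlen⟩
  have hT' : ∀ t ∈ T, t.1 ∈ vertexWords n W ∧ t.2 ∈ vertexWords n W :=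
    fun t ht => mem_listPairs.1 ((List.mem_sublists'.1 hT).subset ht)
  exact ⟨T, hT', hspan.forcesAll hT', hlen⟩

end Algorithm

/-! ### From the combinatorial minimum to the corank. -/

section Corank

theorem groupRank_closure_le {G : Type*} [Group G] (T : Set G) :
    groupRank (Subgroup.closure T) ≤ Cardinal.mk T := by
  have h : Subgroup.closure (Subtype.val ⁻¹' T : Set (Subgroup.closure T)) = ⊤ :=
    Subgroup.closure_closure_coe_preimage
  exact ((groupRank_isLeast (Subgroup.closure T)).2 ⟨_, h, rfl⟩).trans
    (Cardinal.mk_preimage_of_injective _ _ Subtype.val_injective)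

theorem joinCorank_le_of_closure_union {G : Type*} [Group G] {S T : Set G}
    (h : Subgroup.closure (S ∪ T) = ⊤) : joinCorank (Subgroup.closure S) ≤ Cardinal.mk T := by
  have h1 : IsJoinComplement (Subgroup.closure S) (Subgroup.closure T) := by
    rw [IsJoinComplement, ← Subgroup.closure_union, h]
  have h2 : joinCorank (Subgroup.closure S) ≤ groupRank (Subgroup.closure T) :=
    csInf_le' ⟨_, h1, rfl⟩
  exact h2.trans (groupRank_closure_le T)

/-- Both minima are attained: take a complement of least rank and a least generating set of it.
Coranks thus count elements to adjoin to `S`. -/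
theorem exists_closure_union_eq_top {G : Type*} [Group G] (S : Set G) :
    ∃ T : Set G, Subgroup.closure (S ∪ T) = ⊤ ∧
      Cardinal.mk T = joinCorank (Subgroup.closure S) := by
  obtain ⟨K, hK, hrank⟩ := (joinCorank_isLeast (Subgroup.closure S)).1
  obtain ⟨T, hT, hcard⟩ := (groupRank_isLeast K).1
  refine ⟨K.subtype '' T, ?_, ?_⟩
  · rw [Subgroup.closure_union, ← MonoidHom.map_closure, hT, ← MonoidHom.range_eq_map,
      Subgroup.range_subtype]
    exact hK
  · rw [Cardinal.mk_image_eq (Subgroup.subtype_injective K), hcard, hrank]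

theorem mk_pairGenerators_le (n : ℕ) (T : List (List (ℕ × Bool) × List (ℕ × Bool))) :
    Cardinal.mk (pairGenerators n T) ≤ T.length := by
  classical
  have h : pairGenerators n T =
      ((T.map fun t => (natWord n t.2)⁻¹ * natWord n t.1).toFinset : Set _) := by
    ext g; simp [pairGenerators]
  rw [h]
  simp only [Finset.coe_sort_coe, Cardinal.mk_coe_finset]
  exact_mod_cast (List.toFinset_card_le _).trans (by simp)

theorem corankOfWords_eq {n : ℕ} {W : List (List (ℕ × Bool))}
    (hW : ∀ w ∈ W, ∀ x ∈ w, x.1 < n) :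
    (corankOfWords (n, W) : Cardinal) = joinCorank (Subgroup.closure (wordGenerators n W)) := by
  have hle : ∀ T : List (List (ℕ × Bool) × List (ℕ × Bool)),
      (∀ t ∈ T, t.1 ∈ vertexWords n W ∧ t.2 ∈ vertexWords n W) → ForcesAll n W T →
        joinCorank (Subgroup.closure (wordGenerators n W)) ≤ T.length := fun T hT h =>
    (joinCorank_le_of_closure_union ((forcesAll_iff hW hT).1 h)).trans (mk_pairGenerators_le n T)
  -- The letters generate everything, so `n` is a legitimate starting value for the search.
  have hrank : joinCorank (Subgroup.closure (wordGenerators n W)) ≤ n := by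
    have h := joinCorank_le_of_closure_union (S := wordGenerators n W)
      (T := Set.range (FreeGroup.of : Fin n → FreeGroup (Fin n))) (by
        rw [Subgroup.closure_union, FreeGroup.closure_range_of, sup_top_eq])
    exact h.trans (Cardinal.mk_range_le.trans (by simp))
  apply le_antisymm
  · obtain ⟨T, hT, hcard⟩ := exists_closure_union_eq_top (wordGenerators n W)
    rw [← hcard] at hrank ⊢
    -- A least set of added generators has at most `n` elements, so it can be listed and spelled out
    -- as petals.
    have hfin : T.Finite := Cardinal.lt_aleph0_iff_set_finite.1
      (hrank.trans_lt Cardinal.natCast_lt_aleph0)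
    lift T to Finset (FreeGroup (Fin n)) using hfin
    obtain ⟨T', hlen, hT', hforces⟩ := exists_forcesAll_of_closure_eq_top hW T.toList
      (by simpa using hT)
    have := corankOfWords_le_length hT' hforces
    simp only [Finset.coe_sort_coe, Cardinal.mk_coe_finset]
    simp only [Finset.length_toList] at hlen
    exact_mod_cast this.trans hlen
  · rcases corankOfWords_attained n W with h | ⟨T, hT, hforces, hlen⟩
    · rw [h]; exact hrank
    · rw [← hlen]; exact hle T hT hforces

theorem inputWords_letter_lt {n : ℕ} (W : List (List (Fin n × Bool))) :
    ∀ w ∈ inputWords W, ∀ x ∈ w, x.1 < n := by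
  simp only [inputWords, List.mem_map]
  rintro _ ⟨w, -, rfl⟩ x hx
  obtain ⟨y, -, rfl⟩ := List.mem_map.1 hx
  exact y.1.2

theorem wordGenerators_inputWords {n : ℕ} {W : List (List (Fin n × Bool))}
    {S : Finset (FreeGroup (Fin n))} (h : RepresentsSubset W S) :
    wordGenerators n (inputWords W) = (S : Set (FreeGroup (Fin n))) := by
  ext g
  rw [Finset.mem_coe, h g]
  simp [wordGenerators, inputWords, natWord_map_val]

end Corank

/-! ### The search is primitive recursive. -/

section Primrec

variable {α β : Type*} [Primcodable α] [Primcodable β]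

/-- Every quantifier in `IsClosedRel` and `IsSpanning` ranges over a list computed from the input,
so bounded quantification suffices. -/
theorem PrimrecPred.ball {f : α → List β} {p : α → β → Prop} (hf : Primrec f)
    (hp : PrimrecPred fun x : α × β => p x.1 x.2) : PrimrecPred fun a => ∀ b ∈ f a, p a b :=
  (PrimrecRel.forall_mem_list (R := fun b a => p a b)
    (hp.comp (Primrec.snd.pair Primrec.fst))).comp hf Primrec.id

theorem PrimrecPred.list_mem {f : α → List β} {g : α → β} (hf : Primrec f) (hg : Primrec g) :
    PrimrecPred fun a => g a ∈ f a :=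
  ((PrimrecRel.exists_mem_list Primrec.eq).comp hf hg).of_eq (by simp)

theorem PrimrecPred.imp {p q : α → Prop} (hp : PrimrecPred p) (hq : PrimrecPred q) :
    PrimrecPred fun a => p a → q a :=
  (hp.not.or hq).of_eq fun _ => imp_iff_not_or.symm

theorem PrimrecPred.iff {p q : α → Prop} (hp : PrimrecPred p) (hq : PrimrecPred q) :
    PrimrecPred fun a => p a ↔ q a :=
  ((hp.imp hq).and (hq.imp hp)).of_eq fun _ => iff_def.symm

theorem Primrec.list_tails : Primrec (List.tails : List α → List (List α)) := by
  refine (Primrec.list_rec (h := fun (_ : List α) (x : α × List α × List (List α)) =>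
    (x.1 :: x.2.1) :: x.2.2) Primrec.id (Primrec.const [[]]) ?_).of_eq ?_
  · exact Primrec.list_cons.comp
      (Primrec.list_cons.comp (Primrec.fst.comp Primrec.snd)
        (Primrec.fst.comp (Primrec.snd.comp Primrec.snd)))
      (Primrec.snd.comp (Primrec.snd.comp Primrec.snd))
  · intro l
    induction l with
    | nil => rfl
    | cons x l ih => simpa using ih

theorem Primrec.list_sublists' : Primrec (List.sublists' : List α → List (List α)) := by
  refine (Primrec.list_foldr (h := fun (_ : List α) (x : α × List (List α)) =>
    x.2 ++ x.2.map (List.cons x.1)) Primrec.id (Primrec.const [[]]) ?_).of_eq ?_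
  · refine Primrec.list_append.comp (Primrec.snd.comp Primrec.snd)
      (Primrec.list_map (Primrec.snd.comp Primrec.snd) ?_)
    exact Primrec.list_cons.comp (Primrec.fst.comp (Primrec.snd.comp Primrec.fst)) Primrec.snd
  · intro l
    induction l with
    | nil => rfl
    | cons x l ih => simp only [id, List.foldr_cons, List.sublists'_cons] at ih ⊢; rw [ih]

theorem Primrec.listPairs : Primrec (_root_.listPairs : List α → List (α × α)) :=
  Primrec.list_flatMap Primrec.id
    (Primrec.list_map Primrec.fst ((Primrec.snd.comp Primrec.fst).pair Primrec.snd))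

theorem primrec_vertexWords {n : α → ℕ} {W : α → List (List (ℕ × Bool))} (hn : Primrec n)
    (hW : Primrec W) : Primrec fun a => vertexWords (n a) (W a) := by
  refine Primrec.list_cons.comp (Primrec.const []) (Primrec.list_append.comp
    (Primrec.list_map (Primrec.list_range.comp hn) ?_)
    (Primrec.list_flatMap hW (Primrec.list_tails.comp Primrec.snd)))
  exact Primrec.list_cons.comp (Primrec.snd.pair (Primrec.const true)) (Primrec.const [])

theorem primrecPred_wordStep {i : α → ℕ} {p q : α → List (ℕ × Bool)} (hi : Primrec i)
    (hp : Primrec p) (hq : Primrec q) : PrimrecPred fun a => WordStep (i a) (p a) (q a) :=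
  (Primrec.eq.comp hq (Primrec.list_cons.comp (hi.pair (Primrec.const true)) hp)).or
    (Primrec.eq.comp hp (Primrec.list_cons.comp (hi.pair (Primrec.const false)) hq))

theorem primrecPred_isClosedRel {n : α → ℕ} {W : α → List (List (ℕ × Bool))}
    {R : α → List (List (ℕ × Bool) × List (ℕ × Bool))} (hn : Primrec n) (hW : Primrec W)
    (hR : Primrec R) : PrimrecPred fun a => IsClosedRel (n a) (W a) (R a) := by
  have hP := primrec_vertexWords hn hW
  refine .and ?_ (.and ?_ (.and ?_ ?_))
  · exact .ball hP (.list_mem (hR.comp Primrec.fst) (Primrec.snd.pair Primrec.snd))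
  · have h1 : Primrec fun x : (((α × List (ℕ × Bool)) × List (ℕ × Bool)) × List (ℕ × Bool)) =>
        x.1.1.1 := Primrec.fst.comp (Primrec.fst.comp Primrec.fst)
    have hx : Primrec fun x : (((α × List (ℕ × Bool)) × List (ℕ × Bool)) × List (ℕ × Bool)) =>
        x.1.1.2 := Primrec.snd.comp (Primrec.fst.comp Primrec.fst)
    have hy : Primrec fun x : (((α × List (ℕ × Bool)) × List (ℕ × Bool)) × List (ℕ × Bool)) =>
        x.1.2 := Primrec.snd.comp Primrec.fst
    have hz : Primrec fun x : (((α × List (ℕ × Bool)) × List (ℕ × Bool)) × List (ℕ × Bool)) =>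
        x.2 := Primrec.snd
    exact .ball hP (.ball (hP.comp Primrec.fst) (.ball (hP.comp (Primrec.fst.comp Primrec.fst))
      (.imp (.list_mem (hR.comp h1) (hx.pair hy)) (.imp (.list_mem (hR.comp h1) (hx.pair hz))
        (.list_mem (hR.comp h1) (hy.pair hz))))))
  -- The nested tuple is `(((((a, i), x), y), x'), y')`, in the order of the quantifiers; `g1`
  -- extracts `((a, i), x)`.
  · have g1 : Primrec fun x : (((((α × ℕ) × List (ℕ × Bool)) × List (ℕ × Bool)) ×
        List (ℕ × Bool)) × List (ℕ × Bool)) => x.1.1.1 :=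
      Primrec.fst.comp (Primrec.fst.comp Primrec.fst)
    have ha := (Primrec.fst.comp Primrec.fst).comp g1
    have hi := (Primrec.snd.comp Primrec.fst).comp g1
    have hx := Primrec.snd.comp g1
    have hy : Primrec fun x : (((((α × ℕ) × List (ℕ × Bool)) × List (ℕ × Bool)) ×
        List (ℕ × Bool)) × List (ℕ × Bool)) => x.1.1.2 :=
      Primrec.snd.comp (Primrec.fst.comp Primrec.fst)
    have hx' : Primrec fun x : (((((α × ℕ) × List (ℕ × Bool)) × List (ℕ × Bool)) ×
        List (ℕ × Bool)) × List (ℕ × Bool)) => x.1.2 := Primrec.snd.comp Primrec.fst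
    have hy' : Primrec fun x : (((((α × ℕ) × List (ℕ × Bool)) × List (ℕ × Bool)) ×
        List (ℕ × Bool)) × List (ℕ × Bool)) => x.2 := Primrec.snd
    refine .ball (Primrec.list_range.comp hn) (.ball (hP.comp Primrec.fst)
      (.ball (hP.comp (Primrec.fst.comp Primrec.fst))
      (.ball (hP.comp (Primrec.fst.comp (Primrec.fst.comp Primrec.fst)))
      (.ball (hP.comp (Primrec.fst.comp (Primrec.fst.comp (Primrec.fst.comp Primrec.fst))))
        (.imp (primrecPred_wordStep hi hx hx') (.imp (primrecPred_wordStep hi hy hy')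
          (.iff (.list_mem (hR.comp ha) (hx.pair hy)) (.list_mem (hR.comp ha) (hx'.pair hy')))))))))
  · exact .ball hW (.list_mem (hR.comp Primrec.fst) (Primrec.snd.pair (Primrec.const [])))

theorem primrecPred_isSpanning {n : α → ℕ} {W : α → List (List (ℕ × Bool))}
    {T : α → List (List (ℕ × Bool) × List (ℕ × Bool))} (hn : Primrec n) (hW : Primrec W)
    (hT : Primrec T) : PrimrecPred fun a => IsSpanning (n a) (W a) (T a) := by
  refine .ball (Primrec.list_sublists'.comp (Primrec.listPairs.comp (primrec_vertexWords hn hW)))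
    (.imp (primrecPred_isClosedRel (hn.comp Primrec.fst) (hW.comp Primrec.fst) Primrec.snd)
      (.imp (.ball (hT.comp Primrec.fst) (.list_mem (Primrec.snd.comp Primrec.fst) Primrec.snd))
        (.ball (Primrec.list_range.comp (hn.comp Primrec.fst))
          (.list_mem (Primrec.snd.comp Primrec.fst) (.pair ?_ (Primrec.const []))))))
  exact Primrec.list_cons.comp (Primrec.snd.pair (Primrec.const true)) (Primrec.const [])

theorem primrec_corankOfWords : Primrec corankOfWords := by
  classical
  unfold corankOfWords
  refine Primrec.list_foldr (h := fun (a : ℕ × List (List (ℕ × Bool))) x =>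
    if IsSpanning a.1 a.2 x.1 ∧ x.1.length < x.2 then x.1.length else x.2)
    (Primrec.list_sublists'.comp (Primrec.listPairs.comp
      (primrec_vertexWords Primrec.fst Primrec.snd))) Primrec.fst ?_
  have hT : Primrec fun x : (ℕ × List (List (ℕ × Bool))) ×
      (List (List (ℕ × Bool) × List (ℕ × Bool)) × ℕ) => x.2.1 := Primrec.fst.comp Primrec.snd
  have hr : Primrec fun x : (ℕ × List (List (ℕ × Bool))) ×
      (List (List (ℕ × Bool) × List (ℕ × Bool)) × ℕ) => x.2.2 := Primrec.snd.comp Primrec.snd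
  exact Primrec.ite ((primrecPred_isSpanning (Primrec.fst.comp Primrec.fst)
    (Primrec.snd.comp Primrec.fst) hT).and (Primrec.nat_lt.comp (Primrec.list_length.comp hT) hr))
    (Primrec.list_length.comp hT) hr

end Primrec

/-- A single algorithm (a computable function in the sense of recursion theory) takes `n` and a
list of words representing a finite subset `S` of the free group on `n` letters, and outputs the
`∨`-corank of the subgroup generated by `S`. -/
theorem mainTheorem6 :
    ∃ corankAlg : ℕ × List (List (ℕ × Bool)) → ℕ, Computable corankAlg ∧
      ∀ (n : ℕ) (S : Finset (FreeGroup (Fin n))) (W : List (List (Fin n × Bool))),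
        RepresentsSubset W S →
          (corankAlg (n, inputWords W) : Cardinal) =
            joinCorank (Subgroup.closure (S : Set (FreeGroup (Fin n)))) := by
  refine ⟨corankOfWords, primrec_corankOfWords.to_comp, fun n S W h => ?_⟩
  rw [corankOfWords_eq (inputWords_letter_lt W), wordGenerators_inputWords h]
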